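/- **Model.** Let $\Pi\subset\mathbb Z_{\ge 0}^N$ be a finite set of schedules, $\mathcal X,\mathcal Y$ finite alphabets and $C=(C_{x,y})$ a channel, i.e. an $\mathcal X\times\mathcal Y$ row-stochastic matrix. Let $\mathcal M_e=\{0,1\}^k$ and $\mathcal M_r=\{0,1\}^v$ be the encoder and receiver memories. The system has memory-feedback. An encoding policy $\phi\in\Phi_k$ and an allocation policy $\psi=(\psi_a,\psi_m)\in\Psi_v$ are (measurable) functions that determine $$(X(t),M_e(t))=\phi\big(Q(t-1),A(t-1),M_e(t-1),M_r(t-1),U_e(t-1)\big),$$ $$D(t)=\psi_a\big(Y(t),M_r(t-1),U_r(t-1)\big)\in\Pi,\qquad M_r(t)=\psi_m\big(Y(t-1),M_r(t-1),U_r(t-1)\big),$$ $$Q(t)=(Q(t-1)-D(t))^+ + A(t),$$ with $X(t)\in\mathcal X$, $Y(t)\in\mathcal Y$, independent Bernoulli arrivals $A_i(t)$ of mean $\lambda_i\in[0,1]$, and $U_e,U_r$ i.i.d. uniform on $(0,1)$. The state $W(t)=(Q(t),A(t),M_e(t),X(t),M_r(t))$ is the Markov chain with the following transitions: given $W(t-1)$,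 the message $Y(t-1)$ in the update of $M_r$ has law $C_{X(t-1),\cdot}$, the message $Y(t)$ in $D(t)$ has law $C_{X(t),\cdot}$ given also $X(t)$, and $A(t)$, $U_e(t-1)$, $U_r(t-1)$ and the channel noises are independent. The pair $(\phi,\psi)$ stabilizes $\lambda$, written $\lambda\in\tilde\Lambda(\phi,\psi)$, if $W$ is irreducible and positive recurrent on its state space $\mathcal S$ (a nonempty set of states that $W$ does not leave). Let $R\subseteq\mathcal X\times\mathcal M_r$ be the set of values of $(X,M_r)$ on $\mathcal S$; if every value occurs, $R=\mathcal X\times\mathcal M_r$. **Simple policies.** Signals are written into $\lceil\log_2|\mathcal X|\rceil$ bits by a fixed injection. An encoding policy $\phi^0\in\Phi_{\lceil\log_2|\mathcal X|\rceil}$ is simple for $\psi$ if (1) it always sets $M_e(t)=X(t)$; (2) it does not depend on $Q(t-1)$ or $A(t-1)$; (3) under $(\phi^0,\psi)$ the process $(X(t),M_r(t))$ is a homogeneous Markov chain, irreducible on its state space, which is here $R$. Its stationary service rate vector is $\mu(\phi^0,\psi)=\gamma\,C\,\Theta\,S$, where, in the stationary regime of $(X,M_r)$, $\gamma_x=\mathbb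 P(X(t)=x)$, $\Theta_{y,d}=\mathbb P(D(t)=d\mid Y(t)=y)$ (any value if $\mathbb P(Y(t)=y)=0$), and $S_{d,i}=d_i$ for $d\in\Pi$. **Proposition.** Let $k,v\ge 0$, $\phi\in\Phi_k$, $\psi\in\Psi_v$ and $\lambda\in\tilde\Lambda(\phi,\psi)$. Then there is a simple encoding policy $\phi^0$ for $\psi$ (so that $(X,M_r)$ is an irreducible Markov chain on $R$ under $(\phi^0,\psi)$, with a unique stationary distribution) such that $$\mu_i(\phi^0,\psi)\ \ge\ \lambda_i\qquad\text{for all } i=1,\dots,N.$$ -/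

import Mathlib

open scoped ENNReal

noncomputable section

/-! ### Markov chains on a discrete state space, given by their transition matrices -/

namespace Chain

variable {α : Type*}

open Classical in
/-- The `n`-step transition probabilities of the transition matrix `P`. -/
def nStep (P : α → α → ℝ≥0∞) : ℕ → α → α → ℝ≥0∞
  | 0, a, b => if a = b then 1 else 0
  | n + 1, a, b => ∑' c, P a c * nStep P n c b

/-- The chain with transition matrix `P`, run on the state space `S`, is irreducible: `S` is
nonempty, the chain never leaves `S`, and all states of `S` can be reached from one another. -/
def IrreducibleOn (P : α → α → ℝ≥0∞) (S : Set α) : Prop :=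
  S.Nonempty ∧ (∀ a ∈ S, ∀ b ∉ S, P a b = 0) ∧ ∀ a ∈ S, ∀ b ∈ S, ∃ n, 0 < nStep P n a b

open Classical in
/-- `avoid P z n a` is the probability that the chain started at `a` is not in `z` at any of the
times `1, …, n`, that is, `ℙ_a (T_z > n)` where `T_z ≥ 1` is the hitting (return) time of `z`. -/
def avoid (P : α → α → ℝ≥0∞) (z : α) : ℕ → α → ℝ≥0∞
  | 0, _ => 1
  | n + 1, a => ∑' c, if c = z then 0 else P a c * avoid P z n c

/-- The mean return time `𝔼_z [T_z] = ∑_{n ≥ 0} ℙ_z (T_z > n)`. -/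
def meanReturnTime (P : α → α → ℝ≥0∞) (z : α) : ℝ≥0∞ :=
  ∑' n, avoid P z n z

/-- All states of `S` are positive recurrent: their mean return times are finite. -/
def PositiveRecurrentOn (P : α → α → ℝ≥0∞) (S : Set α) : Prop :=
  ∀ z ∈ S, meanReturnTime P z ≠ ∞

/-- `r` is a stationary distribution of the chain with transition matrix `P` run on `S`. -/
def IsStationaryOn (P : α → α → ℝ≥0∞) (S : Set α) (r : PMF α) : Prop :=
  r.support ⊆ S ∧ ∀ b, ∑' a, r a * P a b = r b

end Chain

/-! ### Stochastic processing under imperfect information, with memory-feedback -/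

namespace SPII

/-- The uniform distribution on `(0, 1)`. -/
def uniform01 : MeasureTheory.Measure ℝ :=
  MeasureTheory.volume.restrict (Set.Ioo 0 1)

/-- The contents of a memory of `k` bits. -/
abbrev Mem (k : ℕ) : Type := Fin k → Bool

/-- A (memoryless, stationary) channel: for each input signal a distribution of the output
message. -/
abbrev Channel (X Y : Type*) := X → PMF Y

/-- The row-stochastic channel matrix. -/
def Channel.matrix {X Y : Type*} (C : Channel X Y) : Matrix X Y ℝ :=
  fun x y => (C x y).toReal

/-- An encoding policy with `k` bits of memory, in a system with memory-feedback:
`(X(t), M_e(t)) = φ (Q(t-1), A(t-1), M_e(t-1), M_r(t-1), U_e(t-1))`. -/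
structure EncodingPolicy (N : ℕ) (X : Type*) (k v : ℕ) where
  run : (Fin N → ℕ) → (Fin N → Bool) → Mem k → Mem v → ℝ → X × Mem k
  measurable_run : ∀ q a me mr o, MeasurableSet {u | run q a me mr u = o}

/-- An allocation policy with `v` bits of memory and schedule set `Sched`:
`D(t) = ψ_a (Y(t), M_r(t-1), U_r(t-1))` and `M_r(t) = ψ_m (Y(t-1), M_r(t-1), U_r(t-1))`. -/
structure AllocationPolicy {N : ℕ} (Sched : Finset (Fin N → ℕ)) (Y : Type*) (v : ℕ) where
  alloc : Y → Mem v → ℝ → (Fin N → ℕ)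
  mem : Y → Mem v → ℝ → Mem v
  alloc_mem : ∀ y mr u, alloc y mr u ∈ Sched
  measurable_alloc : ∀ y mr d, MeasurableSet {u | alloc y mr u = d}
  measurable_mem : ∀ y mr mr', MeasurableSet {u | mem y mr u = mr'}

/-- The system state `W(t) = (Q(t), A(t), M_e(t), X(t), M_r(t))`. Arrivals are Bernoulli, so
`A_i(t)` is stored as a Boolean. -/
@[ext]
structure State (N : ℕ) (X : Type*) (k v : ℕ) where
  queue : Fin N → ℕ
  arr : Fin N → Bool
  memE : Mem k
  sig : X
  memR : Mem v

/-- The pair `(X(t), M_r(t))` read off from `W(t)`. -/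
def State.signalMem {N : ℕ} {X : Type*} {k v : ℕ} (w : State N X k v) : X × Mem v :=
  (w.sig, w.memR)

/-- The probability of the arrival vector `a` when the arrivals to the queues are independent
Bernoulli variables with means `lam i`. -/
def arrivalProb {N : ℕ} (lam : Fin N → ℝ) (a : Fin N → Bool) : ℝ≥0∞ :=
  ∏ i, ENNReal.ofReal (if a i then lam i else 1 - lam i)

section Dynamics

variable {N : ℕ} {X Y : Type*} [Fintype X] [Fintype Y] {k v : ℕ} {Sched : Finset (Fin N → ℕ)}

/-- The transition matrix of the Markov chain `W`, from `w = W(t-1)` to `w' = W(t)`. Given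
`W(t-1) = w`, the message `y = Y(t-1)` used for updating the receiver memory has law `C (X(t-1))`,
whatever the other components of `w` are; given moreover `X(t)`, the message `y' = Y(t)` used for
the allocation has law `C (X(t))`; and `A(t)`, `U_e(t-1)`, `U_r(t-1)` and the channel noises are
independent. The first event is about `U_e(t-1)`, the second one about `U_r(t-1)`. The queues follow
`Q(t) = (Q(t-1) - D(t))⁺ + A(t)`; the subtraction of natural numbers is the positive part of the
difference. -/
def transition (C : Channel X Y) (φ : EncodingPolicy N X k v) (ψ : AllocationPolicy Sched Y v)
    (lam : Fin N → ℝ) (w w' : State N X k v) : ℝ≥0∞ :=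
  arrivalProb lam w'.arr *
    uniform01 {u | φ.run w.queue w.arr w.memE w.memR u = (w'.sig, w'.memE)} *
    ∑ y, ∑ y', C w.sig y * C w'.sig y' *
      uniform01 {u | ψ.mem y w.memR u = w'.memR ∧
        w'.queue = fun i => w.queue i - ψ.alloc y' w.memR u i + (w'.arr i).toNat}

/-- The capacity region of the policy pair `(φ, ψ)` for state space `S`: the arrival rate vectors
(of Bernoulli arrivals) under which the chain `W`, run on its state space `S`, is irreducible and
positive recurrent, that is, under which the system is stable. -/
def capacityRegion (C : Channel X Y) (φ : EncodingPolicy N X k v) (ψ : AllocationPolicy Sched Y v)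
    (S : Set (State N X k v)) : Set (Fin N → ℝ) :=
  {lam | (∀ i, lam i ∈ Set.Icc (0 : ℝ) 1) ∧
    Chain.IrreducibleOn (transition C φ ψ lam) S ∧
    Chain.PositiveRecurrentOn (transition C φ ψ lam) S}

/-- An injective way to write signals into an encoder memory of `⌈log₂ |X|⌉` bits. -/
abbrev SignalCode (X : Type*) [Fintype X] : Type _ := X ↪ Mem (Nat.clog 2 (Fintype.card X))

/-- For an encoding policy that ignores queues and arrivals and stores the last signal: the
probability that the next signal is `x'` when the last signal is `x` and the receiver memory is
`m`. -/
def signalProb (enc : SignalCode X) (φ : EncodingPolicy N X (Nat.clog 2 (Fintype.card X)) v)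
    (x : X) (m : Mem v) (x' : X) : ℝ≥0∞ :=
  uniform01 {u | (φ.run (fun _ => 0) (fun _ => false) (enc x) m u).1 = x'}

/-- The transition matrix of `(X, M_r)` under an encoding policy that ignores queues and arrivals
and stores the last signal. -/
def signalMemTransition (C : Channel X Y) (enc : SignalCode X)
    (φ : EncodingPolicy N X (Nat.clog 2 (Fintype.card X)) v) (ψ : AllocationPolicy Sched Y v)
    (p p' : X × Mem v) : ℝ≥0∞ :=
  signalProb enc φ p.1 p.2 p'.1 * ∑ y, C p.1 y * uniform01 {u | ψ.mem y p.2 u = p'.2}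

open Classical in
/-- Simple encoding policies for `ψ`, where `R` is the state space of `(X, M_r)`. -/
structure IsSimple (C : Channel X Y) (enc : SignalCode X) (ψ : AllocationPolicy Sched Y v)
    (R : Set (X × Mem v)) (φ : EncodingPolicy N X (Nat.clog 2 (Fintype.card X)) v) : Prop where
  /-- The encoder memory is set to the current signal. -/
  stores_signal : ∀ q a me mr u, (φ.run q a me mr u).2 = enc (φ.run q a me mr u).1
  /-- The policy uses neither the queue lengths nor the arrivals. -/
  ignores_queues : ∀ q q' a a' me mr u, φ.run q a me mr u = φ.run q' a' me mr u
  /-- `(X, M_r)` is a homogeneous Markov chain: whatever the arrival rates, and from every state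
  `w` of `W` in which the encoder memory holds the signal, the conditional probability of the next
  value of `(X, M_r)` depends only on the present value. -/
  markov : ∀ lam : Fin N → ℝ, (∀ i, lam i ∈ Set.Icc (0 : ℝ) 1) →
    ∀ w : State N X (Nat.clog 2 (Fintype.card X)) v, w.memE = enc w.sig → ∀ p : X × Mem v,
      (∑' w', if w'.signalMem = p then transition C φ ψ lam w w' else 0) =
        signalMemTransition C enc φ ψ w.signalMem p
  /-- This Markov chain is irreducible. -/
  irreducible : Chain.IrreducibleOn (signalMemTransition C enc φ ψ) R

/-! Stationary service rates under a simple policy. Below `r` is the law of `(X(t-1), M_r(t-1))`. -/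

/-- `γ_x = ℙ (X(t) = x)` in the stationary regime. -/
def signalFreq (r : PMF (X × Mem v)) : X → ℝ :=
  fun x => ∑ m, (r (x, m)).toReal

/-- `ℙ (Y(t) = y, D(t) = d)` in the stationary regime. -/
def messageAllocProb (C : Channel X Y) (enc : SignalCode X)
    (φ : EncodingPolicy N X (Nat.clog 2 (Fintype.card X)) v) (ψ : AllocationPolicy Sched Y v)
    (r : PMF (X × Mem v)) (y : Y) (d : Fin N → ℕ) : ℝ :=
  ∑ x, ∑ m, ∑ x', (r (x, m) * signalProb enc φ x m x' * C x' y *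
    uniform01 {u | ψ.alloc y m u = d}).toReal

/-- The rate allocation matrix `Θ_{y,d} = ℙ (D(t) = d | Y(t) = y)` in the stationary regime. -/
def rateAllocation (C : Channel X Y) (enc : SignalCode X)
    (φ : EncodingPolicy N X (Nat.clog 2 (Fintype.card X)) v) (ψ : AllocationPolicy Sched Y v)
    (r : PMF (X × Mem v)) : Matrix Y Sched ℝ :=
  fun y d => messageAllocProb C enc φ ψ r y d / ∑ d' ∈ Sched, messageAllocProb C enc φ ψ r y d'

/-- The schedule matrix. -/
def scheduleMatrix (Sched : Finset (Fin N → ℕ)) : Matrix Sched (Fin N) ℝ :=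
  fun d i => (d.1 i : ℝ)

/-- The stationary service rate vector `μ = γ C Θ S`. -/
def serviceRate (C : Channel X Y) (enc : SignalCode X)
    (φ : EncodingPolicy N X (Nat.clog 2 (Fintype.card X)) v) (ψ : AllocationPolicy Sched Y v)
    (r : PMF (X × Mem v)) : Fin N → ℝ :=
  Matrix.vecMul (signalFreq r)
    (C.matrix * rateAllocation C enc φ ψ r * scheduleMatrix Sched)

end Dynamics

end SPII

end

/-! Positive recurrence gives `W` a stationary law `π`; let `r` be its image on `(X, M_r)`. The new
encoder forgets queues and arrivals and draws the next signal from `κ`, the conditional law under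
`π` of the next signal given the present value of `(X, M_r)` (`exists_condProb`).

Nothing relevant is lost by this averaging. Given `W(t-1)`, the update of `M_r` depends only on `(X,
M_r)` and is independent of the next signal. So the stationary flow of `W` between two values of
`(X, M_r)` equals `r` times the new transition matrix (`map_signalMem_mul`). Hence `r` is stationary
for the new chain, which inherits irreducibility on the image of `S`
(`lumped_irreducible_stationary`). The mean allocation is linear in the joint law of the receiver
memory and the next signal, and this law is the same for both encoders (`tsum_mul_sum_encodeProb`);
for the simple encoder it is the service rate (`serviceRate_eq`).

It remains to see that a stationary queue is served at least at its arrival rate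
(`ofReal_le_tsum_alloc`). The mean queue length may be infinite, so the queue is truncated at `n`,
the finite truncated mean is cancelled, and `n` tends to infinity. -/

noncomputable section

/-! ### Invariant measures of irreducible chains, and uniqueness. -/

namespace Chain

variable {α : Type*} {P : α → α → ℝ≥0∞}

/-- A nonnegative function which is invariant under `P` is invariant under `n` steps. -/
theorem tsum_mul_nStep {s : α → ℝ≥0∞} (hs : ∀ b, ∑' a, s a * P a b = s b) (n : ℕ) (b : α) :
    ∑' a, s a * nStep P n a b = s b := by
  induction n generalizing b with
  | zero =>
    rw [tsum_eq_single b]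
    · simp [nStep]
    · intro a ha
      simp [nStep, ha]
  | succ n ih =>
    calc ∑' a, s a * nStep P (n + 1) a b
        = ∑' a, ∑' c, s a * P a c * nStep P n c b := by
          simp only [nStep, ← ENNReal.tsum_mul_left, mul_assoc]
      _ = ∑' c, (∑' a, s a * P a c) * nStep P n c b := by
          rw [ENNReal.tsum_comm]
          simp only [ENNReal.tsum_mul_right]
      _ = s b := by simp only [hs, ih]

theorem mul_nStep_le {s : α → ℝ≥0∞} (hs : ∀ b, ∑' a, s a * P a b = s b) (n : ℕ) (a b : α) :
    s a * nStep P n a b ≤ s b := by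
  rw [← tsum_mul_nStep hs n b]
  exact ENNReal.le_tsum a

/-- A path of positive probability carries mass from `a` to `b`. No normalization of `s` is needed,
so this also applies to differences of stationary laws. -/
theorem ne_zero_of_invariant {S : Set α} (hI : IrreducibleOn P S) {s : α → ℝ≥0∞}
    (hs : ∀ b, ∑' a, s a * P a b = s b) {a b : α} (ha : a ∈ S) (hb : b ∈ S) (h : s a ≠ 0) :
    s b ≠ 0 := by
  obtain ⟨n, hn⟩ := hI.2.2 a ha b hb
  intro h0
  have := mul_nStep_le hs n a b
  rw [h0, nonpos_iff_eq_zero, mul_eq_zero] at this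
  exact this.elim h hn.ne'

theorem IsStationaryOn.ne_zero {S : Set α} (hI : IrreducibleOn P S) {r : PMF α}
    (hr : IsStationaryOn P S r) {a : α} (ha : a ∈ S) : r a ≠ 0 := by
  obtain ⟨b, hb⟩ := r.support_nonempty
  exact ne_zero_of_invariant hI hr.2 (hr.1 hb) ha ((r.mem_support_iff b).1 hb)

theorem IsStationaryOn.eq_zero {S : Set α} {r : PMF α}
    (hr : IsStationaryOn P S r) {a : α} (ha : a ∉ S) : r a = 0 := by
  by_contra h
  exact ha (hr.1 ((r.mem_support_iff a).2 h))

/-- An irreducible chain with finitely many states has at most one stationary distribution. -/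
theorem IsStationaryOn.unique [Finite α] {S : Set α} (hI : IrreducibleOn P S) {r r' : PMF α}
    (hr : IsStationaryOn P S r) (hr' : IsStationaryOn P S r') : r' = r := by
  -- Subtract from `r'` the largest multiple of `r` that it dominates. The remainder is invariant
  -- and vanishes at the minimizer `p`, hence on all of `S`.
  obtain ⟨p, hp, hmin⟩ := Set.exists_min_image S (fun a => r' a / r a) S.toFinite hI.1
  set c := r' p / r p with hc
  have hc_top : c ≠ ∞ := ENNReal.div_ne_top (r'.apply_ne_top p) (hr.ne_zero hI hp)
  have hle : ∀ a, c * r a ≤ r' a := by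
    intro a
    by_cases ha : a ∈ S
    · exact (ENNReal.le_div_iff_mul_le (Or.inl (hr.ne_zero hI ha))
        (Or.inl (r.apply_ne_top a))).1 (hmin a ha)
    · simp [hr.eq_zero ha]
  set s : α → ℝ≥0∞ := fun a => r' a - c * r a with hsdef
  have hadd : ∀ a, s a + c * r a = r' a := fun a => tsub_add_cancel_of_le (hle a)
  have hs : ∀ b, ∑' a, s a * P a b = s b := by
    intro b
    have h1 : ∑' a, s a * P a b + c * r b = s b + c * r b := by
      rw [hadd b, ← hr'.2 b]
      conv_lhs => rw [← hr.2 b]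
      rw [← ENNReal.tsum_mul_left, ← ENNReal.tsum_add]
      refine tsum_congr fun a => ?_
      rw [← hadd a]
      ring
    exact (ENNReal.add_left_inj (ENNReal.mul_ne_top hc_top (r.apply_ne_top b))).1 h1
  have hsp : s p = 0 := by
    simp only [hsdef, hc]
    rw [ENNReal.div_mul_cancel (hr.ne_zero hI hp) (r.apply_ne_top p), tsub_self]
  have hmul : ∀ a, r' a = c * r a := by
    intro a
    by_cases ha : a ∈ S
    · have : s a = 0 := by
        by_contra h
        exact ne_zero_of_invariant hI hs ha hp h hsp
      rw [← hadd a, this, zero_add]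
    · simp [hr.eq_zero ha, hr'.eq_zero ha]
  have hc1 : c = 1 := by
    have := r'.tsum_coe
    simp only [hmul, ENNReal.tsum_mul_left, r.tsum_coe, mul_one] at this
    exact this
  ext a
  rw [hmul a, hc1, one_mul]

/-! ### Existence of a stationary law by the cycle formula. -/

open Classical in
/-- `taboo P z n b` is the probability that the chain started at `z` is at `b` at time `n` and has
not returned to `z` by then. -/
def taboo (P : α → α → ℝ≥0∞) (z : α) : ℕ → α → ℝ≥0∞
  | 0, b => if b = z then 1 else 0
  | n + 1, b => if b = z then 0 else ∑' a, taboo P z n a * P a b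

/-- Markov property at time `n`: avoiding `z` up to time `n + m` is split at the position at time
`n`. The induction moves one step at a time from the past factor to the future one. -/
theorem tsum_taboo_mul_avoid (z : α) (n m : ℕ) :
    ∑' b, taboo P z n b * avoid P z m b = avoid P z (n + m) z := by
  classical
  induction n generalizing m with
  | zero =>
    rw [tsum_eq_single z]
    · simp [taboo]
    · intro a ha
      simp [taboo, ha]
  | succ n ih =>
    calc ∑' b, taboo P z (n + 1) b * avoid P z m b
        = ∑' b, ∑' a, taboo P z n a * (if b = z then 0 else P a b * avoid P z m b) := by
          refine tsum_congr fun b => ?_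
          by_cases hb : b = z
          · simp [taboo, hb]
          · simp only [taboo, hb, if_false, ← ENNReal.tsum_mul_right, mul_assoc]
      _ = ∑' a, taboo P z n a * avoid P z (m + 1) a := by
          rw [ENNReal.tsum_comm]
          refine tsum_congr fun a => ?_
          rw [ENNReal.tsum_mul_left]
          congr 1
      _ = avoid P z (n + 1 + m) z := by
          rw [ih]
          congr 1
          ring

theorem tsum_taboo (z : α) (n : ℕ) : ∑' b, taboo P z n b = avoid P z n z := by
  simpa [avoid] using tsum_taboo_mul_avoid (P := P) z n 0

theorem taboo_eq_zero {S : Set α} (hS : ∀ a ∈ S, ∀ b ∉ S, P a b = 0) {z : α} (hz : z ∈ S) (n : ℕ)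
    {b : α} (hb : b ∉ S) : taboo P z n b = 0 := by
  have hbz : b ≠ z := fun h => hb (h ▸ hz)
  induction n generalizing b with
  | zero => simp [taboo, hbz]
  | succ n ih =>
    simp only [taboo, hbz, if_false, ENNReal.tsum_eq_zero]
    intro a
    by_cases ha : a ∈ S
    · simp [hS a ha b hb]
    · simp [ih ha (fun h => ha (h ▸ hz))]

/-- The expected number of visits to `b` during an excursion from `z`. -/
def excursion (P : α → α → ℝ≥0∞) (z b : α) : ℝ≥0∞ := ∑' n, taboo P z n b

theorem tsum_excursion (z : α) : ∑' b, excursion P z b = meanReturnTime P z := by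
  simp only [excursion, meanReturnTime]
  rw [ENNReal.tsum_comm]
  simp only [tsum_taboo]

theorem excursion_self (z : α) : excursion P z z = 1 := by
  rw [excursion, tsum_eq_single 0]
  · simp [taboo]
  · intro n hn
    obtain ⟨m, rfl⟩ := Nat.exists_eq_succ_of_ne_zero hn
    simp [taboo]

/-- A chain that has not returned by time `n` either returns at time `n + 1` or still avoids `z`;
summed over `n`, this telescopes. -/
theorem tsum_return_add (hP : ∀ a, ∑' b, P a b = 1) (z : α) (n : ℕ) :
    ∑' a, taboo P z n a * P a z + avoid P z (n + 1) z = avoid P z n z := by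
  classical
  have h1 : ∀ a, P a z + avoid P z 1 a = 1 := by
    intro a
    rw [← hP a, ENNReal.tsum_eq_add_tsum_ite z]
    simp only [avoid, mul_one]
  rw [← tsum_taboo_mul_avoid z n 1, ← ENNReal.tsum_add, ← tsum_taboo z n]
  refine tsum_congr fun a => ?_
  rw [← mul_add, h1, mul_one]

/-- Off `z`, this is the recursion for `taboo`. At `z`, the left side is the probability of ever
returning, which is `1`: the tails of the return time are summable and so tend to `0`. -/
theorem excursion_invariant (hP : ∀ a, ∑' b, P a b = 1) {z : α} (hz : meanReturnTime P z ≠ ∞)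
    (b : α) : ∑' a, excursion P z a * P a b = excursion P z b := by
  have hswap : ∑' a, excursion P z a * P a b = ∑' n, ∑' a, taboo P z n a * P a b := by
    simp only [excursion, ← ENNReal.tsum_mul_right]
    exact ENNReal.tsum_comm
  rw [hswap]
  by_cases hb : b = z
  · subst hb
    rw [excursion_self]
    have hpart : ∀ n, ∑ i ∈ Finset.range n, ∑' a, taboo P b i a * P a b + avoid P b n b = 1 := by
      intro n
      induction n with
      | zero => simp [avoid]
      | succ n ih => rw [Finset.sum_range_succ, add_assoc, tsum_return_add hP, ih]
    have hlim := (ENNReal.tendsto_nat_tsum fun n => ∑' a, taboo P b n a * P a b).add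
      (ENNReal.tendsto_atTop_zero_of_tsum_ne_top hz)
    simp only [hpart, add_zero] at hlim
    exact tendsto_nhds_unique hlim tendsto_const_nhds
  · conv_rhs => rw [excursion, tsum_eq_zero_add' ENNReal.summable]
    simp [taboo, hb]

/-- A positive recurrent irreducible chain has a stationary distribution. -/
theorem exists_isStationaryOn {S : Set α} (hP : ∀ a, ∑' b, P a b = 1) (hI : IrreducibleOn P S)
    (hR : PositiveRecurrentOn P S) : ∃ r : PMF α, IsStationaryOn P S r := by
  obtain ⟨z, hz⟩ := hI.1
  have hsum := tsum_excursion (P := P) z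
  have h0 : ∑' b, excursion P z b ≠ 0 := by
    intro h
    have := ENNReal.tsum_eq_zero.1 h z
    simp [excursion_self] at this
  have htop : ∑' b, excursion P z b ≠ ∞ := hsum ▸ hR z hz
  refine ⟨PMF.normalize (excursion P z) h0 htop, ?_, ?_⟩
  · intro b hb
    by_contra hbS
    rw [PMF.mem_support_normalize_iff] at hb
    apply hb
    simp [excursion, taboo_eq_zero hI.2.1 hz _ hbS]
  · intro b
    simp only [PMF.normalize_apply]
    rw [← excursion_invariant hP (hR z hz) b, ← ENNReal.tsum_mul_right]
    refine tsum_congr fun a => ?_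
    ring

end Chain

/-! ### Marginals of the uniform variable and of the arrivals. -/

namespace SPII

instance : MeasureTheory.IsProbabilityMeasure uniform01 :=
  ⟨by simp [uniform01]⟩

/-- Restricting `μ` to the event `p` makes this a partition by the values of `f`; only the level
sets of `f` have to be measurable. -/
theorem sum_measure_and {β : Type*} (μ : MeasureTheory.Measure ℝ) (s : Finset β) (f : ℝ → β)
    (p : ℝ → Prop) (hf : ∀ b, MeasurableSet {u | f u = b}) (hs : ∀ u, f u ∈ s) :
    ∑ b ∈ s, μ {u | p u ∧ f u = b} = μ {u | p u} := by
  have h := MeasureTheory.sum_measure_preimage_singleton (μ := μ.restrict {u | p u}) s (f := f)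
    (fun b _ => hf b)
  have huniv : f ⁻¹' (s : Set β) = Set.univ := Set.eq_univ_of_forall hs
  rw [huniv, MeasureTheory.Measure.restrict_apply_univ] at h
  rw [← h]
  refine Finset.sum_congr rfl fun b _ => ?_
  have h' : f ⁻¹' {b} = {u | f u = b} := rfl
  rw [h', MeasureTheory.Measure.restrict_apply (hf b)]
  congr 1
  ext u
  exact and_comm

theorem sum_measure_eq {β : Type*} (s : Finset β) (f : ℝ → β)
    (hf : ∀ b, MeasurableSet {u | f u = b}) (hs : ∀ u, f u ∈ s) :
    ∑ b ∈ s, uniform01 {u | f u = b} = 1 := by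
  simpa using sum_measure_and uniform01 s f (fun _ => True) hf hs

theorem sum_pmf {β : Type*} [Fintype β] (p : PMF β) : ∑ b, p b = 1 := by
  simpa using p.tsum_coe

section Arrivals

variable {N : ℕ} {lam : Fin N → ℝ}

theorem sum_bernoulli {t : ℝ} (ht : t ∈ Set.Icc (0 : ℝ) 1) :
    ∑ b : Bool, ENNReal.ofReal (if b then t else 1 - t) = 1 := by
  rw [Fintype.sum_bool]
  simp only [if_true, Bool.false_eq_true, if_false]
  rw [← ENNReal.ofReal_add ht.1 (sub_nonneg.2 ht.2)]
  simp

theorem sum_arrivalProb (hlam : ∀ i, lam i ∈ Set.Icc (0 : ℝ) 1) :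
    ∑ a, arrivalProb lam a = 1 := by
  simp only [arrivalProb]
  rw [← Fintype.prod_sum fun j (b : Bool) => ENNReal.ofReal (if b then lam j else 1 - lam j)]
  exact Finset.prod_eq_one fun i _ => sum_bernoulli (hlam i)

theorem sum_arrivalProb_mul (hlam : ∀ i, lam i ∈ Set.Icc (0 : ℝ) 1) (i : Fin N) :
    ∑ a, arrivalProb lam a * ((a i).toNat : ℝ≥0∞) = ENNReal.ofReal (lam i) := by
  -- The factor of coordinate `i` is spread over all coordinates, with `1` elsewhere, so that the
  -- sum factorizes.
  have h : ∀ a : Fin N → Bool, arrivalProb lam a * ((a i).toNat : ℝ≥0∞) =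
      ∏ j, ENNReal.ofReal (if a j then lam j else 1 - lam j) *
        (if j = i then ((a j).toNat : ℝ≥0∞) else 1) := by
    intro a
    rw [Finset.prod_mul_distrib, Finset.prod_ite_eq' Finset.univ i]
    simp [arrivalProb]
  simp only [h]
  rw [← Fintype.prod_sum fun j (b : Bool) => ENNReal.ofReal (if b then lam j else 1 - lam j) *
        (if j = i then (b.toNat : ℝ≥0∞) else 1), Finset.prod_eq_single i]
  · simp
  · intro j _ hj
    simp only [hj, if_false, mul_one]
    exact sum_bernoulli (hlam j)
  · simp

end Arrivals

/-! ### One-step expectations of the chain `W`. -/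

section Dynamics

variable {N : ℕ} {X Y : Type*} [Fintype X] [Fintype Y] {k v : ℕ} {Sched : Finset (Fin N → ℕ)}

/-- A state, as a tuple of its components. -/
def stateEquiv (N : ℕ) (X : Type*) (k v : ℕ) :
    State N X k v ≃ (Fin N → Bool) × X × Mem v × Mem k × (Fin N → ℕ) where
  toFun w := (w.arr, w.sig, w.memR, w.memE, w.queue)
  invFun p := ⟨p.2.2.2.2, p.1, p.2.2.2.1, p.2.1, p.2.2.1⟩
  left_inv _ := rfl
  right_inv _ := rfl

theorem tsum_state (F : State N X k v → ℝ≥0∞) :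
    ∑' w, F w = ∑ a, ∑ x, ∑ m, ∑ me, ∑' q, F ⟨q, a, me, x, m⟩ := by
  rw [← (stateEquiv N X k v).symm.tsum_eq]
  rw [ENNReal.tsum_prod', tsum_fintype]
  refine Finset.sum_congr rfl fun a _ => ?_
  rw [ENNReal.tsum_prod', tsum_fintype]
  refine Finset.sum_congr rfl fun x _ => ?_
  rw [ENNReal.tsum_prod', tsum_fintype]
  refine Finset.sum_congr rfl fun m _ => ?_
  rw [ENNReal.tsum_prod', tsum_fintype]
  rfl

/-- The probability that the next signal is `x` when the present state is `w`. -/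
def encodeProb (φ : EncodingPolicy N X k v) (w : State N X k v) (x : X) : ℝ≥0∞ :=
  uniform01 {u | (φ.run w.queue w.arr w.memE w.memR u).1 = x}

omit [Fintype X] in
theorem measurableSet_run_fst (φ : EncodingPolicy N X k v) (w : State N X k v) (x : X) :
    MeasurableSet {u | (φ.run w.queue w.arr w.memE w.memR u).1 = x} := by
  have : {u | (φ.run w.queue w.arr w.memE w.memR u).1 = x} =
      ⋃ me, {u | φ.run w.queue w.arr w.memE w.memR u = (x, me)} := by
    ext u
    simp [Prod.ext_iff]
  rw [this]
  exact MeasurableSet.iUnion fun me => φ.measurable_run _ _ _ _ _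

theorem sum_encodeProb (φ : EncodingPolicy N X k v) (w : State N X k v) :
    ∑ x, encodeProb φ w x = 1 :=
  sum_measure_eq Finset.univ _ (measurableSet_run_fst φ w) fun _ => Finset.mem_univ _

theorem sum_measure_run (φ : EncodingPolicy N X k v) (w : State N X k v) (x : X) :
    ∑ me, uniform01 {u | φ.run w.queue w.arr w.memE w.memR u = (x, me)} = encodeProb φ w x := by
  rw [encodeProb, ← sum_measure_and uniform01 Finset.univ
    (fun u => (φ.run w.queue w.arr w.memE w.memR u).2)]
  · simp only [Prod.ext_iff]
  · intro me
    have : {u | (φ.run w.queue w.arr w.memE w.memR u).2 = me} =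
        ⋃ x, {u | φ.run w.queue w.arr w.memE w.memR u = (x, me)} := by
      ext u
      simp [Prod.ext_iff]
    rw [this]
    exact MeasurableSet.iUnion fun me => φ.measurable_run _ _ _ _ _
  · exact fun _ => Finset.mem_univ _

/-- The expectation of a function of the next arrivals, signal, receiver memory, and of the present
allocation, when the system is in state `w`. -/
def expect (C : Channel X Y) (φ : EncodingPolicy N X k v) (ψ : AllocationPolicy Sched Y v)
    (lam : Fin N → ℝ) (w : State N X k v)
    (H : (Fin N → Bool) → X → Mem v → (Fin N → ℕ) → ℝ≥0∞) : ℝ≥0∞ :=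
  ∑ a, arrivalProb lam a * ∑ x, encodeProb φ w x * ∑ y', C x y' * ∑ y, C w.sig y *
    ∑ d ∈ Sched, ∑ m, uniform01 {u | ψ.mem y w.memR u = m ∧ ψ.alloc y' w.memR u = d} * H a x m d

variable (C : Channel X Y) (φ : EncodingPolicy N X k v) (ψ : AllocationPolicy Sched Y v)
    {lam : Fin N → ℝ} (w : State N X k v)

theorem expect_add (H H' : (Fin N → Bool) → X → Mem v → (Fin N → ℕ) → ℝ≥0∞) :
    expect C φ ψ lam w (fun a x m d => H a x m d + H' a x m d) =
      expect C φ ψ lam w H + expect C φ ψ lam w H' := by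
  simp only [expect, mul_add, Finset.sum_add_distrib]

theorem expect_mono {H H' : (Fin N → Bool) → X → Mem v → (Fin N → ℕ) → ℝ≥0∞}
    (h : ∀ a x m d, H a x m d ≤ H' a x m d) :
    expect C φ ψ lam w H ≤ expect C φ ψ lam w H' := by
  unfold expect
  gcongr
  exact h _ _ _ _

/-- The expectation of a function of the next signal and the present allocation. -/
theorem expect_sig_alloc (hlam : ∀ i, lam i ∈ Set.Icc (0 : ℝ) 1) (g : X → (Fin N → ℕ) → ℝ≥0∞) :
    expect C φ ψ lam w (fun _ x _ d => g x d) =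
      ∑ x, encodeProb φ w x * ∑ y', C x y' *
        ∑ d ∈ Sched, uniform01 {u | ψ.alloc y' w.memR u = d} * g x d := by
  have h : ∀ y y' d, ∑ m, uniform01 {u | ψ.mem y w.memR u = m ∧ ψ.alloc y' w.memR u = d} =
      uniform01 {u | ψ.alloc y' w.memR u = d} := by
    intro y y' d
    simp only [and_comm (b := ψ.alloc y' w.memR _ = d)]
    exact sum_measure_and uniform01 Finset.univ _ _ (ψ.measurable_mem y w.memR)
      fun _ => Finset.mem_univ _
  simp only [expect, ← Finset.sum_mul, h, sum_pmf, one_mul, sum_arrivalProb hlam]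

/-- The expectation of a function of the next arrivals. -/
theorem expect_arr (g : (Fin N → Bool) → ℝ≥0∞) :
    expect C φ ψ lam w (fun a _ _ _ => g a) = ∑ a, arrivalProb lam a * g a := by
  have h : ∀ y y' d, ∑ m, uniform01 {u | ψ.mem y w.memR u = m ∧ ψ.alloc y' w.memR u = d} =
      uniform01 {u | ψ.alloc y' w.memR u = d} := by
    intro y y' d
    simp only [and_comm (b := ψ.alloc y' w.memR _ = d)]
    exact sum_measure_and uniform01 Finset.univ _ _ (ψ.measurable_mem y w.memR)
      fun _ => Finset.mem_univ _
  have h' : ∀ y', ∑ d ∈ Sched, uniform01 {u | ψ.alloc y' w.memR u = d} = 1 := fun y' =>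
    sum_measure_eq Sched _ (ψ.measurable_alloc y' w.memR) (ψ.alloc_mem y' w.memR)
  simp only [expect, ← Finset.sum_mul, h, h', sum_pmf, one_mul, sum_encodeProb]

/-- The expectation of a function of the next signal and receiver memory. -/
theorem expect_sig_mem (hlam : ∀ i, lam i ∈ Set.Icc (0 : ℝ) 1) (g : X → Mem v → ℝ≥0∞) :
    expect C φ ψ lam w (fun _ x m _ => g x m) =
      ∑ x, encodeProb φ w x * ∑ y, C w.sig y *
        ∑ m, uniform01 {u | ψ.mem y w.memR u = m} * g x m := by
  have h : ∀ y y' m, ∑ d ∈ Sched, uniform01 {u | ψ.mem y w.memR u = m ∧ ψ.alloc y' w.memR u = d} =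
      uniform01 {u | ψ.mem y w.memR u = m} := fun y y' m =>
    sum_measure_and uniform01 Sched _ _ (ψ.measurable_alloc y' w.memR) (ψ.alloc_mem y' w.memR)
  simp only [expect, Finset.sum_comm (s := Sched), ← Finset.sum_mul, h, sum_pmf, one_mul,
    sum_arrivalProb hlam]

-- Different schedules can lead to the same queue because of the positive part, so the event is
-- first partitioned by the allocation; each part then fixes `q`.
omit [Fintype Y] in
theorem tsum_measure_queue (y y' : Y) (mr m : Mem v) (f : (Fin N → ℕ) → Fin N → ℕ)
    (G : (Fin N → ℕ) → ℝ≥0∞) :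
    ∑' q, uniform01 {u | ψ.mem y mr u = m ∧ q = f (ψ.alloc y' mr u)} * G q =
      ∑ d ∈ Sched, uniform01 {u | ψ.mem y mr u = m ∧ ψ.alloc y' mr u = d} * G (f d) := by
  classical
  have h : ∀ q, uniform01 {u | ψ.mem y mr u = m ∧ q = f (ψ.alloc y' mr u)} * G q =
      ∑ d ∈ Sched, if q = f d then
        uniform01 {u | ψ.mem y mr u = m ∧ ψ.alloc y' mr u = d} * G (f d) else 0 := by
    intro q
    rw [← sum_measure_and uniform01 Sched (ψ.alloc y' mr) _ (ψ.measurable_alloc y' mr)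
      (ψ.alloc_mem y' mr), Finset.sum_mul]
    refine Finset.sum_congr rfl fun d _ => ?_
    split_ifs with hq
    · rw [hq]
      congr 2
      ext u
      simp only [Set.mem_ofPred_eq]
      constructor
      · rintro ⟨⟨h1, -⟩, h2⟩
        exact ⟨h1, h2⟩
      · rintro ⟨h1, h2⟩
        exact ⟨⟨h1, by rw [h2]⟩, h2⟩
    · have : {u | (ψ.mem y mr u = m ∧ q = f (ψ.alloc y' mr u)) ∧ ψ.alloc y' mr u = d} = ∅ := by
        ext u
        simp only [Set.mem_ofPred_eq, Set.mem_empty_iff_false, iff_false]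
        rintro ⟨⟨-, h1⟩, h2⟩
        exact hq (h2 ▸ h1)
      rw [this]
      simp
  simp only [h]
  rw [Summable.tsum_finsetSum fun _ _ => ENNReal.summable]
  refine Finset.sum_congr rfl fun d _ => ?_
  rw [tsum_ite_eq]

/-- Expectations over the next state. -/
theorem tsum_transition_mul (G : X → Mem v → (Fin N → ℕ) → ℝ≥0∞) :
    ∑' w', transition C φ ψ lam w w' * G w'.sig w'.memR w'.queue =
      expect C φ ψ lam w
        (fun a x m d => G x m (fun i => w.queue i - d i + (a i).toNat)) := by
  rw [tsum_state, expect]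
  refine Finset.sum_congr rfl fun a _ => ?_
  rw [Finset.mul_sum]
  refine Finset.sum_congr rfl fun x _ => ?_
  have h1 : ∀ m, ∑ me, ∑' q, transition C φ ψ lam w ⟨q, a, me, x, m⟩ * G x m q =
      arrivalProb lam a * (encodeProb φ w x * ∑ y', C x y' * ∑ y, C w.sig y *
        ∑ d ∈ Sched, uniform01 {u | ψ.mem y w.memR u = m ∧ ψ.alloc y' w.memR u = d} *
          G x m (fun i => w.queue i - d i + (a i).toNat)) := by
    intro m
    rw [← sum_measure_run, Finset.sum_mul, Finset.mul_sum]
    refine Finset.sum_congr rfl fun me _ => ?_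
    simp only [transition, mul_assoc, ENNReal.tsum_mul_left]
    congr 2
    simp only [← tsum_measure_queue ψ _ _ _ _ (fun d i => w.queue i - d i + (a i).toNat),
      ← ENNReal.tsum_mul_left, Finset.sum_mul]
    rw [Summable.tsum_finsetSum fun _ _ => ENNReal.summable]
    simp only [Summable.tsum_finsetSum fun _ _ => ENNReal.summable, Finset.mul_sum]
    rw [Finset.sum_comm]
    refine Finset.sum_congr rfl fun y' _ => Finset.sum_congr rfl fun y _ => ?_
    rw [← ENNReal.tsum_mul_left]
    refine tsum_congr fun q => ?_
    ring
  simp only [h1, ← Finset.mul_sum]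
  congr 2
  rw [Finset.sum_comm]
  refine Finset.sum_congr rfl fun y' _ => ?_
  rw [← Finset.mul_sum]
  congr 1
  rw [Finset.sum_comm]
  refine Finset.sum_congr rfl fun y _ => ?_
  rw [← Finset.mul_sum, Finset.sum_comm]

theorem tsum_transition (hlam : ∀ i, lam i ∈ Set.Icc (0 : ℝ) 1) :
    ∑' w', transition C φ ψ lam w w' = 1 := by
  have h := tsum_transition_mul C φ ψ (lam := lam) w fun _ _ _ => 1
  simp only [mul_one] at h
  rw [h, expect_arr C φ ψ w fun _ => 1]
  simp [sum_arrivalProb hlam]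

open Classical in
theorem tsum_transition_signalMem (hlam : ∀ i, lam i ∈ Set.Icc (0 : ℝ) 1) (p : X × Mem v) :
    (∑' w', if w'.signalMem = p then transition C φ ψ lam w w' else 0) =
      encodeProb φ w p.1 * ∑ y, C w.sig y * uniform01 {u | ψ.mem y w.memR u = p.2} := by
  -- The test function is the indicator of `p`, written as a product so that the sums over signal
  -- and memory separate.
  have h := tsum_transition_mul C φ ψ (lam := lam) w
    fun x m _ => (if x = p.1 then 1 else 0) * (if m = p.2 then 1 else 0)
  rw [expect_sig_mem C φ ψ w hlam
    fun x m => (if x = p.1 then 1 else 0) * (if m = p.2 then 1 else 0)] at h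
  convert h using 1
  · refine tsum_congr fun w' => ?_
    simp only [State.signalMem, Prod.ext_iff]
    split_ifs <;> simp_all
  · rw [Finset.sum_eq_single p.1]
    · simp
    · intro x _ hx
      simp [hx]
    · simp

end Dynamics

/-! ### Realizing a signal law by randomization, and the simple policy. -/

/-- Every distribution on a finite type is the law of a function of a uniform variable. -/
theorem exists_uniform01_eq {X : Type*} [Fintype X] (p : PMF X) :
    ∃ f : ℝ → X, (∀ x, MeasurableSet {u | f u = x}) ∧ ∀ x, uniform01 {u | f u = x} = p x := by
  let _ : MeasurableSpace X := ⊤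
  have : DiscreteMeasurableSpace X := ⟨fun _ => trivial⟩
  have : Nonempty X := ⟨p.support_nonempty.some⟩
  obtain ⟨f, hf, hfp⟩ := p.toMeasure.exists_measurable_map_eq
  -- The representing map lives on the closed unit interval; it is extended to the line by
  -- projection, and the two endpoints are null.
  have hm : Measurable fun u : ℝ => f (Set.projIcc 0 1 zero_le_one u) :=
    hf.comp continuous_projIcc.measurable
  refine ⟨fun u => f (Set.projIcc 0 1 zero_le_one u), fun x => hm (measurableSet_singleton x),
    fun x => ?_⟩
  have h1 : p.toMeasure {x} = p x := p.toMeasure_apply_singleton x (measurableSet_singleton x)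
  rw [← h1, ← hfp, MeasureTheory.Measure.map_apply hf (measurableSet_singleton x),
    unitInterval.volume_apply, uniform01,
    MeasureTheory.Measure.restrict_congr_set MeasureTheory.Ioo_ae_eq_Icc]
  refine (MeasureTheory.Measure.restrict_apply (hm (measurableSet_singleton x))).trans ?_
  congr 1
  ext u
  constructor
  · rintro ⟨h, hu⟩
    refine ⟨⟨u, hu⟩, ?_, rfl⟩
    have h' : f (Set.projIcc 0 1 zero_le_one u) = x := h
    rwa [Set.projIcc_of_mem zero_le_one hu] at h'
  · rintro ⟨⟨u, hu⟩, h, rfl⟩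
    refine ⟨?_, hu⟩
    change f (Set.projIcc 0 1 zero_le_one u) = x
    rw [Set.projIcc_of_mem zero_le_one hu]
    exact h

section Dynamics

variable {N : ℕ} {X Y : Type*} [Fintype X] [Fintype Y] {k v : ℕ} {Sched : Finset (Fin N → ℕ)}

/-- The encoding policy which draws the next signal from a function `g` of the last signal, the
receiver memory and the randomization, and stores the signal. -/
def signalPolicy (N : ℕ) [Nonempty X] (enc : SignalCode X) (g : X → Mem v → ℝ → X)
    (hg : ∀ x m x', MeasurableSet {u | g x m u = x'}) :
    EncodingPolicy N X (Nat.clog 2 (Fintype.card X)) v where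
  -- Memory contents outside the range of `enc` decode to an arbitrary signal; the policy itself
  -- only ever writes contents in the range.
  run _ _ me mr u := (g (Function.invFun enc me) mr u, enc (g (Function.invFun enc me) mr u))
  measurable_run := by
    rintro - - me mr ⟨x, me'⟩
    by_cases h : enc x = me'
    · convert hg (Function.invFun enc me) mr x using 1
      ext u
      simp only [Set.mem_ofPred_eq, Prod.mk.injEq]
      exact ⟨fun h' => h'.1, fun h' => ⟨h', by rw [h', h]⟩⟩
    · convert MeasurableSet.empty (α := ℝ)
      ext u
      simp only [Set.mem_ofPred_eq, Prod.mk.injEq, Set.mem_empty_iff_false, iff_false]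
      rintro ⟨h1, h2⟩
      exact h (h1 ▸ h2)

section SignalPolicy

variable [Nonempty X] (C : Channel X Y) (enc : SignalCode X) (ψ : AllocationPolicy Sched Y v)
  (g : X → Mem v → ℝ → X) (hg : ∀ x m x', MeasurableSet {u | g x m u = x'})

theorem signalProb_signalPolicy (x : X) (m : Mem v) (x' : X) :
    signalProb enc (signalPolicy N enc g hg) x m x' = uniform01 {u | g x m u = x'} := by
  simp only [signalProb, signalPolicy, Function.leftInverse_invFun enc.injective x]

/-- The law of the next pair depends on `w` beyond `(X, M_r)` only through the encoder, which here
sees just the stored signal and the receiver memory. -/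
theorem isSimple_signalPolicy {R : Set (X × Mem v)}
    (hR : Chain.IrreducibleOn (signalMemTransition C enc (signalPolicy N enc g hg) ψ) R) :
    IsSimple C enc ψ R (signalPolicy N enc g hg) where
  stores_signal _ _ _ _ _ := rfl
  ignores_queues _ _ _ _ _ _ _ := rfl
  markov lam hlam w hw p := by
    rw [tsum_transition_signalMem C _ ψ w hlam p]
    simp only [encodeProb, hw]
    rfl
  irreducible := hR

end SignalPolicy

/-! ### Averaging the encoder, and the rate bound for stable queues. -/

section Stationary

variable {C : Channel X Y} {φ : EncodingPolicy N X k v} {ψ : AllocationPolicy Sched Y v}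
  {lam : Fin N → ℝ}

omit [Fintype X] in
open Classical in
theorem map_signalMem_apply (π : PMF (State N X k v)) (p : X × Mem v) :
    π.map State.signalMem p = ∑' w, if p = w.signalMem then π w else 0 := by
  rw [PMF.map_apply]
  refine tsum_congr fun w => ?_
  congr

open Classical in
/-- A version of the conditional law of the next signal given the signal and the receiver memory,
when `π` is the law of the state. -/
theorem exists_condProb (φ : EncodingPolicy N X k v) (π : PMF (State N X k v)) :
    ∃ κ : X × Mem v → PMF X, ∀ p x, π.map State.signalMem p * κ p x =
      ∑' w, (if p = w.signalMem then π w else 0) * encodeProb φ w x := by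
  set r := π.map State.signalMem with hr
  have hrp : ∀ p, r p = ∑' w, if p = w.signalMem then π w else 0 := map_signalMem_apply π
  have hsum : ∀ p, ∑ x, ∑' w, (if p = w.signalMem then π w else 0) * encodeProb φ w x = r p := by
    intro p
    rw [← Summable.tsum_finsetSum fun _ _ => ENNReal.summable]
    simp only [← Finset.mul_sum, sum_encodeProb, mul_one, hrp]
  have key : ∀ p, ∃ κ : PMF X, ∀ x, r p * κ x =
      ∑' w, (if p = w.signalMem then π w else 0) * encodeProb φ w x := by
    intro p
    by_cases h0 : r p = 0
    -- On a null value of `(X, M_r)` any law will do, since both sides vanish.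
    · refine ⟨PMF.pure p.1, fun x => ?_⟩
      have h := hsum p
      rw [h0, Finset.sum_eq_zero_iff] at h
      rw [h0, zero_mul, h x (Finset.mem_univ x)]
    · refine ⟨PMF.ofFintype (fun x =>
        (∑' w, (if p = w.signalMem then π w else 0) * encodeProb φ w x) / r p) ?_, fun x => ?_⟩
      · simp only [div_eq_mul_inv]
        rw [← Finset.sum_mul, hsum p, ENNReal.mul_inv_cancel h0 (r.apply_ne_top p)]
      · rw [PMF.ofFintype_apply, ENNReal.mul_div_cancel h0 (r.apply_ne_top p)]
  choose κ hκ using key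
  exact ⟨κ, hκ⟩

-- Tower property: replacing the encoder by its conditional law does not change the mean of a
-- function of `(X, M_r)` and the next signal. This transfers the mean allocation to the simple
-- policy.
open Classical in
theorem tsum_mul_sum_encodeProb {π : PMF (State N X k v)} {κ : X × Mem v → PMF X}
    (hκ : ∀ p x, π.map State.signalMem p * κ p x =
      ∑' w, (if p = w.signalMem then π w else 0) * encodeProb φ w x)
    (F : X × Mem v → X → ℝ≥0∞) :
    ∑' w, π w * ∑ x, encodeProb φ w x * F w.signalMem x =
      ∑ p, ∑ x, π.map State.signalMem p * κ p x * F p x := by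
  simp only [hκ, ← ENNReal.tsum_mul_right]
  simp only [← Summable.tsum_finsetSum fun _ _ => ENNReal.summable]
  refine tsum_congr fun w => ?_
  rw [Finset.sum_eq_single w.signalMem]
  · simp [Finset.mul_sum, mul_assoc]
  · intro p _ hp
    simp [hp]
  · simp

/-- If the queues are stable, then they are served at rates no less than the arrival rates. -/
theorem ofReal_le_tsum_alloc (hlam : ∀ i, lam i ∈ Set.Icc (0 : ℝ) 1) {π : PMF (State N X k v)}
    (hπ : ∀ w', ∑' w, π w * transition C φ ψ lam w w' = π w') (i : Fin N) :
    ENNReal.ofReal (lam i) ≤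
      ∑' w, π w * ∑ x, encodeProb φ w x * ∑ y, C x y *
        ∑ d ∈ Sched, uniform01 {u | ψ.alloc y w.memR u = d} * (d i : ℝ≥0∞) := by
  classical
  set D : State N X k v → ℝ≥0∞ := fun w => ∑ x, encodeProb φ w x * ∑ y, C x y *
        ∑ d ∈ Sched, uniform01 {u | ψ.alloc y w.memR u = d} * (d i : ℝ≥0∞) with hD
  -- Drift of the queue truncated at `n`. Arrivals are counted only when the queue is strictly below
  -- `n`: since they are at most `1`, they then survive the truncation.
  have hpt : ∀ (n : ℕ) (w : State N X k v), ((min (w.queue i) n : ℕ) : ℝ≥0∞) +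
      ENNReal.ofReal (lam i) * (if w.queue i < n then 1 else 0) ≤
      ∑' w', transition C φ ψ lam w w' * ((min (w'.queue i) n : ℕ) : ℝ≥0∞) + D w := by
    intro n w
    rw [tsum_transition_mul C φ ψ w fun _ _ q => ((min (q i) n : ℕ) : ℝ≥0∞)]
    have h1 := expect_sig_alloc C φ ψ w hlam fun _ d => (d i : ℝ≥0∞)
    have h2 := expect_arr C φ ψ (lam := lam) w fun a => ((min (w.queue i) n : ℕ) : ℝ≥0∞) +
      ((a i).toNat : ℝ≥0∞) * (if w.queue i < n then 1 else 0)
    simp only [mul_add, Finset.sum_add_distrib, ← Finset.sum_mul, sum_arrivalProb hlam, one_mul,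
      ← mul_assoc, sum_arrivalProb_mul hlam] at h2
    rw [← h2]
    simp only [hD]
    rw [← h1, ← expect_add]
    refine expect_mono C φ ψ w fun a x m d => ?_
    have : min (w.queue i) n + (a i).toNat * (if w.queue i < n then 1 else 0) ≤
        min (w.queue i - d i + (a i).toNat) n + d i := by
      have ha : (a i).toNat ≤ 1 := Bool.toNat_le _
      split_ifs <;> omega
    exact_mod_cast this
  have hn : ∀ n : ℕ, ENNReal.ofReal (lam i) * ∑' w, π w * (if w.queue i < n then 1 else 0) ≤
      ∑' w, π w * D w := by
    intro n
    set B := ∑' w, π w * ((min (w.queue i) n : ℕ) : ℝ≥0∞) with hB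
    -- Truncation is what makes this mean finite, hence cancellable from both sides.
    have hBtop : B ≠ ∞ := by
      refine ne_top_of_le_ne_top (ENNReal.natCast_ne_top n) ?_
      calc B ≤ ∑' w, π w * (n : ℝ≥0∞) := by
            refine ENNReal.tsum_le_tsum fun w => ?_
            gcongr
            exact min_le_right _ _
        _ = n := by rw [ENNReal.tsum_mul_right, π.tsum_coe, one_mul]
    have hinv : ∑' w, π w *
        ∑' w', transition C φ ψ lam w w' * ((min (w'.queue i) n : ℕ) : ℝ≥0∞) = B := by
      simp only [← ENNReal.tsum_mul_left]
      rw [ENNReal.tsum_comm]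
      simp only [← mul_assoc, ENNReal.tsum_mul_right, hπ, hB]
    have h : B + ENNReal.ofReal (lam i) * ∑' w, π w * (if w.queue i < n then 1 else 0) ≤
        B + ∑' w, π w * D w := by
      conv_rhs => rw [← hinv]
      rw [hB, ← ENNReal.tsum_mul_left, ← ENNReal.tsum_add, ← ENNReal.tsum_add]
      refine ENNReal.tsum_le_tsum fun w => ?_
      have := mul_le_mul_right (hpt n w) (π w)
      rw [mul_add, mul_add] at this
      refine le_trans (le_of_eq ?_) this
      ring
    exact (ENNReal.add_le_add_iff_left hBtop).1 h
  -- The mass of `π` is exhausted by finite sets of states; on each of them, every `n` above the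
  -- largest queue makes the indicator equal to `1`.
  rw [← mul_one (ENNReal.ofReal (lam i)), ← π.tsum_coe, ENNReal.tsum_eq_iSup_sum, ENNReal.mul_iSup]
  refine iSup_le fun s => le_trans ?_ (hn (s.sup (fun w => w.queue i) + 1))
  gcongr
  refine le_trans (le_of_eq ?_) (ENNReal.sum_le_tsum s)
  refine Finset.sum_congr rfl fun w hw => ?_
  have : w.queue i < s.sup (fun w => w.queue i) + 1 :=
    Nat.lt_succ_of_le (Finset.le_sup (f := fun w => w.queue i) hw)
  simp [this]

end Stationary

/-! ### The matrix formula as a mean allocation. -/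

section ServiceRate

variable {C : Channel X Y} {enc : SignalCode X}
  {φ : EncodingPolicy N X (Nat.clog 2 (Fintype.card X)) v} {ψ : AllocationPolicy Sched Y v}
  {R : Set (X × Mem v)} {r : PMF (X × Mem v)}

/-- The distribution of the next signal is the stationary one. -/
theorem sum_mul_signalProb
    (hr : Chain.IsStationaryOn (signalMemTransition C enc φ ψ) R r) (x' : X) :
    ∑ p, r p * signalProb enc φ p.1 p.2 x' = ∑ m, r (x', m) := by
  rw [Finset.sum_congr rfl fun m _ => (hr.2 (x', m)).symm]
  simp only [tsum_fintype, signalMemTransition]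
  rw [Finset.sum_comm]
  refine Finset.sum_congr rfl fun p _ => ?_
  -- The memory update has total mass `1`, so summing over the new memory leaves the signal
  -- transition alone.
  have h : ∑ m, ∑ y, C p.1 y * uniform01 {u | ψ.mem y p.2 u = m} = 1 := by
    rw [Finset.sum_comm]
    simp only [← Finset.mul_sum]
    simp only [sum_measure_eq Finset.univ _ (ψ.measurable_mem _ p.2) fun _ => Finset.mem_univ _,
      mul_one, sum_pmf]
  rw [← Finset.mul_sum, ← Finset.mul_sum, h, mul_one]

/-- The service rates are the mean stationary allocations; in particular, they are nonnegative. -/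
theorem serviceRate_eq
    (hr : Chain.IsStationaryOn (signalMemTransition C enc φ ψ) R r) (i : Fin N) :
    ∑ p, ∑ x, r p * signalProb enc φ p.1 p.2 x * ∑ y, C x y *
      ∑ d ∈ Sched, uniform01 {u | ψ.alloc y p.2 u = d} * (d i : ℝ≥0∞) =
    ENNReal.ofReal (serviceRate C enc φ ψ r i) ∧ 0 ≤ serviceRate C enc φ ψ r i := by
  set M : Y → (Fin N → ℕ) → ℝ≥0∞ := fun y d => ∑ x, ∑ m, ∑ x',
    r (x, m) * signalProb enc φ x m x' * C x' y * uniform01 {u | ψ.alloc y m u = d} with hM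
  have hterm : ∀ y d x m x',
      r (x, m) * signalProb enc φ x m x' * C x' y * uniform01 {u | ψ.alloc y m u = d} ≠ ∞ :=
    fun y d x m x' => ENNReal.mul_ne_top (ENNReal.mul_ne_top (ENNReal.mul_ne_top
      (r.apply_ne_top _) (MeasureTheory.measure_ne_top _ _)) ((C x').apply_ne_top y))
      (MeasureTheory.measure_ne_top _ _)
  have hMtop : ∀ y d, M y d ≠ ∞ := fun y d =>
    ENNReal.sum_ne_top.2 fun x _ => ENNReal.sum_ne_top.2 fun m _ =>
      ENNReal.sum_ne_top.2 fun x' _ => hterm y d x m x'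
  have hMreal : ∀ y d, messageAllocProb C enc φ ψ r y d = (M y d).toReal := by
    intro y d
    rw [hM, messageAllocProb]
    rw [ENNReal.toReal_sum fun x _ => ENNReal.sum_ne_top.2 fun m _ =>
      ENNReal.sum_ne_top.2 fun x' _ => hterm y d x m x']
    refine Finset.sum_congr rfl fun x _ => ?_
    rw [ENNReal.toReal_sum fun m _ => ENNReal.sum_ne_top.2 fun x' _ => hterm y d x m x']
    refine Finset.sum_congr rfl fun m _ => ?_
    rw [ENNReal.toReal_sum fun x' _ => hterm y d x m x']
  have hMsum : ∀ y, ∑ d ∈ Sched, M y d = ∑ x, (∑ m, r (x, m)) * C x y := by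
    intro y
    simp only [← sum_mul_signalProb hr, hM, Fintype.sum_prod_type]
    simp only [Finset.sum_comm (s := Sched), ← Finset.mul_sum,
      sum_measure_eq Sched _ (ψ.measurable_alloc y _) (ψ.alloc_mem y _), mul_one, Finset.sum_mul]
    simp only [Finset.sum_comm (s := (Finset.univ : Finset (Mem v)))]
    exact Finset.sum_comm
  have hMsum' : ∀ y, ∑ x, signalFreq r x * C.matrix x y =
      ∑ d ∈ Sched, messageAllocProb C enc φ ψ r y d := by
    intro y
    simp only [hMreal, signalFreq, Channel.matrix]
    rw [← ENNReal.toReal_sum fun d _ => hMtop y d, hMsum y, ENNReal.toReal_sum]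
    · refine Finset.sum_congr rfl fun x _ => ?_
      rw [ENNReal.toReal_mul, ENNReal.toReal_sum fun m _ => r.apply_ne_top _]
    · exact fun x _ => ENNReal.mul_ne_top (ENNReal.sum_ne_top.2 fun m _ => r.apply_ne_top _)
        ((C x).apply_ne_top y)
  have hcancel : ∀ y, ∀ d : Sched, (∑ x, signalFreq r x * C.matrix x y) *
      rateAllocation C enc φ ψ r y d = messageAllocProb C enc φ ψ r y d := by
    intro y d
    rw [hMsum' y, rateAllocation]
    -- For a message of probability `0` the quotient is a default value; it is harmless because the
    -- nonnegative joint probabilities all vanish.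
    by_cases h0 : ∑ d ∈ Sched, messageAllocProb C enc φ ψ r y d = 0
    · rw [h0, zero_mul]
      rw [Finset.sum_eq_zero_iff_of_nonneg fun d _ => by
        rw [hMreal]; exact ENNReal.toReal_nonneg] at h0
      exact (h0 d d.2).symm
    · exact mul_div_cancel₀ _ h0
  have hrate : serviceRate C enc φ ψ r i =
      (∑ y, ∑ d ∈ Sched, M y d * (d i : ℝ≥0∞)).toReal := by
    calc serviceRate C enc φ ψ r i
        = ∑ y, ∑ d : Sched, (∑ x, signalFreq r x * C.matrix x y) *
            rateAllocation C enc φ ψ r y d * (d.1 i : ℝ) := by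
          rw [serviceRate, ← Matrix.vecMul_vecMul, ← Matrix.vecMul_vecMul]
          simp only [Matrix.vecMul, dotProduct, scheduleMatrix, Finset.sum_mul]
          rw [Finset.sum_comm]
      _ = ∑ y, ∑ d ∈ Sched, messageAllocProb C enc φ ψ r y d * (d i : ℝ) := by
          simp only [hcancel]
          refine Finset.sum_congr rfl fun y _ => ?_
          exact Finset.sum_coe_sort Sched fun d => messageAllocProb C enc φ ψ r y d * (d i : ℝ)
      _ = (∑ y, ∑ d ∈ Sched, M y d * (d i : ℝ≥0∞)).toReal := by
          rw [ENNReal.toReal_sum fun y _ => ENNReal.sum_ne_top.2 fun d _ =>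
            ENNReal.mul_ne_top (hMtop y d) (ENNReal.natCast_ne_top _)]
          refine Finset.sum_congr rfl fun y _ => ?_
          rw [ENNReal.toReal_sum fun d _ =>
            ENNReal.mul_ne_top (hMtop y d) (ENNReal.natCast_ne_top _)]
          simp only [hMreal, ENNReal.toReal_mul, ENNReal.toReal_natCast]
  refine ⟨?_, hrate ▸ ENNReal.toReal_nonneg⟩
  rw [hrate, ENNReal.ofReal_toReal (ENNReal.sum_ne_top.2 fun y _ => ENNReal.sum_ne_top.2 fun d _ =>
    ENNReal.mul_ne_top (hMtop y d) (ENNReal.natCast_ne_top _))]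
  simp only [hM, Fintype.sum_prod_type, Finset.sum_mul, Finset.mul_sum]
  simp only [Finset.sum_comm (s := Sched)]
  rw [Finset.sum_comm (s := (Finset.univ : Finset Y))]
  refine Finset.sum_congr rfl fun x _ => ?_
  rw [Finset.sum_comm (s := (Finset.univ : Finset Y))]
  refine Finset.sum_congr rfl fun m _ => ?_
  rw [Finset.sum_comm (s := (Finset.univ : Finset Y))]
  refine Finset.sum_congr rfl fun x' _ => Finset.sum_congr rfl fun y _ =>
    Finset.sum_congr rfl fun d _ => ?_
  ring

end ServiceRate

/-! ### Projection of the stationary chain to `(X, M_r)`. -/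

section Lumping

variable {C : Channel X Y} {φ : EncodingPolicy N X k v} {ψ : AllocationPolicy Sched Y v}
  {lam : Fin N → ℝ}

open Classical in
/-- The flow of a stationary regime between the values of `(X, M_r)`. -/
theorem map_signalMem_mul (hlam : ∀ i, lam i ∈ Set.Icc (0 : ℝ) 1) {π : PMF (State N X k v)}
    {κ : X × Mem v → PMF X} (hκ : ∀ p x, π.map State.signalMem p * κ p x =
      ∑' w, (if p = w.signalMem then π w else 0) * encodeProb φ w x) (p p' : X × Mem v) :
    π.map State.signalMem p * (κ p p'.1 * ∑ y, C p.1 y * uniform01 {u | ψ.mem y p.2 u = p'.2}) =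
      ∑' w, (if p = w.signalMem then π w else 0) *
        ∑' w', if w'.signalMem = p' then transition C φ ψ lam w w' else 0 := by
  rw [← mul_assoc, hκ, ← ENNReal.tsum_mul_right]
  refine tsum_congr fun w => ?_
  rw [tsum_transition_signalMem C φ ψ w hlam p', mul_assoc]
  split_ifs with h
  · subst h
    rfl
  · simp

omit [Fintype X] in
/-- The projection to `(X, M_r)` of an irreducible stationary chain is irreducible, and the
projection of the stationary distribution is stationary. -/
theorem lumped_irreducible_stationary {S : Set (State N X k v)}
    (hI : Chain.IrreducibleOn (transition C φ ψ lam) S) {π : PMF (State N X k v)}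
    (hπ : Chain.IsStationaryOn (transition C φ ψ lam) S π)
    {L : X × Mem v → X × Mem v → ℝ≥0∞}
    (hL : ∀ p p', π.map State.signalMem p * L p p' =
      ∑' w, (open Classical in if p = w.signalMem then π w else 0) *
        ∑' w', open Classical in if w'.signalMem = p' then transition C φ ψ lam w w' else 0) :
    Chain.IrreducibleOn L (State.signalMem '' S) ∧
      Chain.IsStationaryOn L (State.signalMem '' S) (π.map State.signalMem) := by
  classical
  have hr : ∀ w ∈ S, π.map State.signalMem w.signalMem ≠ 0 := by
    intro w hw
    rw [← PMF.mem_support_iff, PMF.support_map]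
    exact ⟨w, (π.mem_support_iff w).2 (hπ.ne_zero hI hw), rfl⟩
  -- A possible step of `W` from a state of positive mass contributes to the flow, so the projected
  -- step has positive probability.
  have hstep : ∀ a ∈ S, ∀ b, transition C φ ψ lam a b ≠ 0 →
      L a.signalMem b.signalMem ≠ 0 := by
    intro a ha b hab h0
    have h := hL a.signalMem b.signalMem
    rw [h0, mul_zero, eq_comm, ENNReal.tsum_eq_zero] at h
    have h1 := h a
    rw [if_pos rfl, mul_eq_zero, ENNReal.tsum_eq_zero] at h1
    rcases h1 with h1 | h1
    · exact hπ.ne_zero hI ha h1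
    · have h2 := h1 b
      rw [if_pos rfl] at h2
      exact hab h2
  have hpath : ∀ n, ∀ a ∈ S, ∀ b ∈ S, Chain.nStep (transition C φ ψ lam) n a b ≠ 0 →
      Chain.nStep L n a.signalMem b.signalMem ≠ 0 := by
    intro n
    induction n with
    | zero =>
      intro a _ b _ h
      have hab : a = b := by
        by_contra hab
        exact h (by simp [Chain.nStep, hab])
      simp [Chain.nStep, hab]
    | succ n ih =>
      intro a ha b hb h h0
      apply h
      simp only [Chain.nStep, ENNReal.tsum_eq_zero, mul_eq_zero] at h0 ⊢
      intro c
      by_contra! hc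
      have hcS : c ∈ S := by
        by_contra hcS
        exact hc.1 (hI.2.1 a ha c hcS)
      rcases h0 c.signalMem with h1 | h1
      · exact hstep a ha c hc.1 h1
      · exact ih c hcS b hb hc.2 h1
  refine ⟨⟨hI.1.image _, ?_, ?_⟩, ?_, ?_⟩
  · rintro _ ⟨a, ha, rfl⟩ p hp
    -- The flow out of the image is zero because `π` lives on `S`, which `W` does not leave; the
    -- positive mass at the projected state is then divided out.
    have h : π.map State.signalMem a.signalMem * L a.signalMem p = 0 := by
      rw [hL, ENNReal.tsum_eq_zero]
      intro w
      by_cases hw : w ∈ S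
      · rw [mul_eq_zero]
        right
        rw [ENNReal.tsum_eq_zero]
        intro w'
        split_ifs with hw'
        · exact hI.2.1 w hw w' fun h => hp ⟨w', h, hw'⟩
        · rfl
      · simp [hπ.eq_zero hw]
    exact (mul_eq_zero.1 h).resolve_left (hr a ha)
  · rintro _ ⟨a, ha, rfl⟩ _ ⟨b, hb, rfl⟩
    obtain ⟨n, hn⟩ := hI.2.2 a ha b hb
    exact ⟨n, pos_iff_ne_zero.2 (hpath n a ha b hb hn.ne')⟩
  · rw [PMF.support_map]
    exact Set.image_mono hπ.1
  · intro p'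
    calc ∑' p, π.map State.signalMem p * L p p'
        = ∑' w, ∑' p, (if p = w.signalMem then π w else 0) *
            ∑' w', if w'.signalMem = p' then transition C φ ψ lam w w' else 0 := by
          simp only [hL]
          exact ENNReal.tsum_comm
      _ = ∑' w, ∑' w', if w'.signalMem = p' then π w * transition C φ ψ lam w w' else 0 := by
          refine tsum_congr fun w => ?_
          rw [ENNReal.tsum_mul_right, tsum_ite_eq, ← ENNReal.tsum_mul_left]
          simp only [mul_ite, mul_zero]
      _ = ∑' w', if w'.signalMem = p' then ∑' w, π w * transition C φ ψ lam w w' else 0 := by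
          rw [ENNReal.tsum_comm]
          refine tsum_congr fun w' => ?_
          split_ifs <;> simp
      _ = π.map State.signalMem p' := by
          simp only [hπ.2, map_signalMem_apply, eq_comm (a := p')]

end Lumping

end Dynamics

end SPII

/-! ### Assembly. -/

theorem mainTheorem5 {N : ℕ} {X Y : Type*} [Fintype X] [Fintype Y]
    (Sched : Finset (Fin N → ℕ)) (C : SPII.Channel X Y) (k v : ℕ)
    (φ : SPII.EncodingPolicy N X k v) (ψ : SPII.AllocationPolicy Sched Y v)
    (S : Set (SPII.State N X k v)) (lam : Fin N → ℝ)
    (hlam : lam ∈ SPII.capacityRegion C φ ψ S) (enc : SPII.SignalCode X) :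
    ∃ φ₀ : SPII.EncodingPolicy N X (Nat.clog 2 (Fintype.card X)) v,
      SPII.IsSimple C enc ψ (SPII.State.signalMem '' S) φ₀ ∧
      ∃ r : PMF (X × SPII.Mem v),
        Chain.IsStationaryOn (SPII.signalMemTransition C enc φ₀ ψ) (SPII.State.signalMem '' S) r ∧
        (∀ r', Chain.IsStationaryOn (SPII.signalMemTransition C enc φ₀ ψ)
          (SPII.State.signalMem '' S) r' → r' = r) ∧
        ∀ i, lam i ≤ SPII.serviceRate C enc φ₀ ψ r i := by
  obtain ⟨h01, hI, hR⟩ := hlam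
  obtain ⟨π, hπ⟩ := Chain.exists_isStationaryOn
    (fun w => SPII.tsum_transition C φ ψ w h01) hI hR
  obtain ⟨κ, hκ⟩ := SPII.exists_condProb φ π
  choose g hg hgκ using fun (x : X) (m : SPII.Mem v) => SPII.exists_uniform01_eq (κ (x, m))
  have : Nonempty X := ⟨hI.1.some.sig⟩
  have hsig : ∀ x m x', SPII.signalProb enc (SPII.signalPolicy N enc g hg) x m x' = κ (x, m) x' :=
    fun x m x' => by rw [SPII.signalProb_signalPolicy, hgκ]
  have hlump := SPII.lumped_irreducible_stationary hI hπ
    (L := SPII.signalMemTransition C enc (SPII.signalPolicy N enc g hg) ψ) fun p p' => by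
      rw [SPII.signalMemTransition, hsig]
      exact SPII.map_signalMem_mul h01 hκ p p'
  refine ⟨SPII.signalPolicy N enc g hg, SPII.isSimple_signalPolicy C enc ψ g hg hlump.1,
    π.map SPII.State.signalMem, hlump.2, fun r' hr' => hlump.2.unique hlump.1 hr', fun i => ?_⟩
  have h := SPII.ofReal_le_tsum_alloc h01 hπ.2 i
  have h' := SPII.tsum_mul_sum_encodeProb hκ fun p x => ∑ y, C x y *
    ∑ d ∈ Sched, SPII.uniform01 {u | ψ.alloc y p.2 u = d} * (d i : ℝ≥0∞)
  have h'' := SPII.serviceRate_eq hlump.2 i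
  simp only [hsig] at h''
  -- Nonnegativity of the service rate is needed to return from extended nonnegative reals to real
  -- numbers.
  rw [← ENNReal.ofReal_le_ofReal_iff h''.2, ← h''.1, ← h']
  exact h

end
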